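/- Let $\mathcal H$ be a finite dimensional real or complex inner product space, let $A:\mathcal H\to\mathcal H$ be a Hermitian linear operator, and let $\mathcal X,\mathcal Y\subseteq\mathcal H$ be subspaces with $\dim\mathcal X=\dim\mathcal Y=p$. Notation. Let $P_{\mathcal Z}$ denote the orthogonal projector onto a subspace $\mathcal Z$. For a Hermitian operator $B$, let $\Lambda(B)$ be the vector of its eigenvalues, repeated according to multiplicity, in decreasing order. Write $\Lambda_{\mathcal X}=\Lambda\big((P_{\mathcal X}A)|_{\mathcal X}\big)$ and $\Lambda_{\mathcal Y}=\Lambda\big((P_{\mathcal Y}A)|_{\mathcal Y}\big)$ for the vectors of Ritz values, and let $\lambda_{\min}$ be the smallest eigenvalue of $(P_{\mathcal X+\mathcal Y}A)|_{\mathcal X+\mathcal Y}$. The vector $\Theta=\Theta(\mathcal X,\mathcal Y)$ of principal angles is in decreasing order with entries in $[0,\pi/2]$, and $\cos^2\Theta$ is the vector of eigenvalues of $(P_{\mathcal X}P_{\mathcal Y})|_{\mathcal X}$ in increasing order. Operations, inequalities and functions of vectors are componentwise. For real vectors $x,y$ of length $p$, $x\prec_w y$ means $\sum_{i=1}^k x_i^{\downarrow}\le\sum_{i=1}^k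 y_i^{\downarrow}$ for $k=1,\dots,p$, where $x^{\downarrow}$ is $x$ rearranged in decreasing order. Theorem. Suppose that $\mathcal X$ is $A$-invariant and corresponds to the contiguous set of the largest eigenvalues of $A$, i.e. $\Lambda_{\mathcal X}$ consists of the $p$ largest eigenvalues of $A$ counted with multiplicity. Suppose also that every entry of $\Theta$ is less than $\pi/2$ and every entry of $\Lambda_{\mathcal X}$ is greater than $\lambda_{\min}$. Then every entry of $\Lambda_{\mathcal Y}$ is greater than $\lambda_{\min}$, $$0\le\log\frac{\Lambda_{\mathcal X}-\lambda_{\min}}{\Lambda_{\mathcal Y}-\lambda_{\min}}\prec_w\log\left(1+\tan^2\Theta\right),$$ and $$0\le\frac{\Lambda_{\mathcal X}-\Lambda_{\mathcal Y}}{\Lambda_{\mathcal Y}-\lambda_{\min}}\prec_w\tan^2\Theta .$$ -/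

import Mathlib

noncomputable section

namespace RitzMajorization

/-- The decreasing rearrangement `x↓` of a real vector `x`. -/
def decreasing {n : ℕ} (x : Fin n → ℝ) : Fin n → ℝ :=
  fun i => x (Tuple.sort x (Fin.rev i))

/-- Weak (sub-)majorization `x ≺_w y`: for every `k = 1, …, n`, the sum of the `k` largest entries
of `x` is at most the sum of the `k` largest entries of `y`. -/
def WeaklyMajorizedBy {n : ℕ} (x y : Fin n → ℝ) : Prop :=
  ∀ k : ℕ, 1 ≤ k → ∀ hk : k ≤ n,
    ∑ i : Fin k, decreasing x (Fin.castLE hk i) ≤ ∑ i : Fin k, decreasing y (Fin.castLE hk i)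

section Operators

variable {𝕜 H : Type*} [RCLike 𝕜] [NormedAddCommGroup H] [InnerProductSpace 𝕜 H]
  [FiniteDimensional 𝕜 H]

/-- The Rayleigh-Ritz operator `(P_X A)|_X : X → X`, where `P_X` is the orthogonal projector
onto `X`. -/
def rayleighRitz (A : H →ₗ[𝕜] H) (X : Submodule 𝕜 H) : X →ₗ[𝕜] X :=
  X.orthogonalProjectionOnto.toLinearMap ∘ₗ A ∘ₗ X.subtype

/-- The Rayleigh-Ritz operator of a Hermitian operator is Hermitian. -/
theorem rayleighRitz_isSymmetric {A : H →ₗ[𝕜] H} (hA : A.IsSymmetric) (X : Submodule 𝕜 H) :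
    (rayleighRitz A X).IsSymmetric := by
  intro x y
  simp only [rayleighRitz, LinearMap.comp_apply, Submodule.subtype_apply,
    ContinuousLinearMap.coe_coe]
  rw [Submodule.inner_orthogonalProjectionOnto_eq_of_mem_right,
    Submodule.inner_orthogonalProjectionOnto_eq_of_mem_left]
  exact hA x y

/-- The vector `Λ((P_X A)|_X)` of Ritz values of the Hermitian operator `A` with respect to `X`,
in decreasing order and repeated according to multiplicity. -/
def ritzValues {A : H →ₗ[𝕜] H} (hA : A.IsSymmetric) (X : Submodule 𝕜 H) {p : ℕ}
    (hp : Module.finrank 𝕜 X = p) : Fin p → ℝ :=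
  (rayleighRitz_isSymmetric hA X).eigenvalues hp

/-- The smallest eigenvalue of `(P_Z A)|_Z`, for a nonzero subspace `Z`
(and `0` for the zero subspace). -/
def minRitzValue {A : H →ₗ[𝕜] H} (hA : A.IsSymmetric) (Z : Submodule 𝕜 H) : ℝ :=
  ⨅ i, ritzValues hA Z rfl i

/-- The subspace `X` is `A`-invariant and corresponds to the contiguous set of the largest
eigenvalues of `A`: the eigenvalues of `A` on `X` are the `dim X` largest eigenvalues of `A`,
counting multiplicities. -/
def IsTopInvariant {A : H →ₗ[𝕜] H} (hA : A.IsSymmetric) (X : Submodule 𝕜 H) : Prop :=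
  (∀ x ∈ X, A x ∈ X) ∧
    ∀ i : Fin (Module.finrank 𝕜 X),
      ritzValues hA X rfl i = hA.eigenvalues rfl (Fin.castLE X.finrank_le i)

/-- The vector `Θ(X, Y)` of principal angles from `X` to `Y`: the angles lie in `[0, π / 2]`, are
arranged in decreasing order, and their squared cosines are the eigenvalues of `(P_X P_Y)|_X`, in
increasing order. -/
def principalAngles (X Y : Submodule 𝕜 H) {p : ℕ} (hp : Module.finrank 𝕜 X = p) : Fin p → ℝ :=
  fun i => Real.arccos (Real.sqrt
    (ritzValues (A := Y.starProjection.toLinearMap) Y.starProjection_isSymmetric X hp (Fin.rev i)))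

end Operators

end RitzMajorization

end

/-!
Let `c` be the smallest Ritz value on `X + Y`, and put `B = (P_X A)|_X - c`, `N = (P_Y A)|_Y - c`
and `K = P_X|_Y : Y → X`. Since `X` is invariant, the quadratic form of `A - c` at `y ∈ Y` is the sum
of its values at `P_X y` and at `y - P_X y`. The latter vector lies in `X + Y`, where the form is
nonnegative, so `N ≥ K* B K` (`re_inner_orthogonalProjection_le`). The eigenvalues of
`K K* = (P_X P_Y)|_X` are the squared cosines of the principal angles. The logarithmic majorization is
therefore the multiplicative Lidskii (Gelfand-Naimark) inequality for `K* B K`, `sum_log_div_le`.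

That inequality follows an argument of Li and Mathias: truncate the eigenvalues of `K K*` at its `k`-th
smallest eigenvalue `s` (`exists_truncation`). This only lowers the eigenvalues of `K* B K`, and
afterwards each of them is at most `s` times the corresponding eigenvalue of `B`, so a product of `k`
ratios is bounded by the product of all of them, which is a quotient of determinants. Every comparison
of eigenvalues used here, including Cauchy interlacing for the nonnegativity claims, is an instance of
one form of the Courant-Fischer principle, `le_eigenvalues_of_injective`.

The second majorization is the image of the first under the increasing convex function
`t ↦ exp t - 1`, which preserves weak majorization (`WeaklyMajorizedBy.exp_sub_one`).
-/

noncomputable section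

namespace RitzMajorization

/-! ### Operators diagonal in an orthonormal basis -/

section Diagonal

variable {𝕜 E : Type*} [RCLike 𝕜] [NormedAddCommGroup E] [InnerProductSpace 𝕜 E]
  {ι : Type*} [Fintype ι]

local notation "⟪" x ", " y "⟫" => inner 𝕜 x y

/-- The operator that multiplies the `i`-th vector of the orthonormal basis `b` by `d i`. -/
def diagonalOperator (b : OrthonormalBasis ι 𝕜 E) (d : ι → ℝ) : E →ₗ[𝕜] E :=
  b.toBasis.constr 𝕜 fun i => (d i : 𝕜) • b i

theorem diagonalOperator_apply_basis (b : OrthonormalBasis ι 𝕜 E) (d : ι → ℝ) (i : ι) :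
    diagonalOperator b d (b i) = (d i : 𝕜) • b i := by
  have h := b.toBasis.constr_basis 𝕜 (fun i => (d i : 𝕜) • b i) i
  rwa [b.coe_toBasis] at h

variable {b : OrthonormalBasis ι 𝕜 E} {T : E →ₗ[𝕜] E} {d : ι → ℝ}

theorem inner_basis_apply (hT : ∀ i, T (b i) = (d i : 𝕜) • b i) (i : ι) (x : E) :
    ⟪b i, T x⟫ = (d i : 𝕜) * ⟪b i, x⟫ := by
  classical
  conv_lhs => rw [← b.sum_repr' x]
  rw [map_sum, inner_sum, Finset.sum_eq_single i]
  · rw [map_smul, hT, inner_smul_right, inner_smul_right, b.inner_eq_one]; ring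
  · intro j _ hj
    rw [map_smul, hT, inner_smul_right, inner_smul_right, b.inner_eq_zero (Ne.symm hj)]; ring
  · simp

theorem re_inner_apply_self (hT : ∀ i, T (b i) = (d i : 𝕜) • b i) (x : E) :
    RCLike.re ⟪T x, x⟫ = ∑ i, d i * ‖⟪b i, x⟫‖ ^ 2 := by
  rw [← b.sum_inner_mul_inner, map_sum]
  refine Finset.sum_congr rfl fun i _ => ?_
  rw [← inner_conj_symm (T x), inner_basis_apply hT, (starRingEnd 𝕜).map_mul, RCLike.conj_ofReal, mul_assoc,
    RCLike.conj_mul, ← RCLike.ofReal_pow, ← RCLike.ofReal_mul, RCLike.ofReal_re]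

theorem norm_sq_apply (hT : ∀ i, T (b i) = (d i : 𝕜) • b i) (x : E) :
    ‖T x‖ ^ 2 = ∑ i, d i ^ 2 * ‖⟪b i, x⟫‖ ^ 2 := by
  rw [← b.sum_sq_norm_inner_right]
  refine Finset.sum_congr rfl fun i _ => ?_
  rw [inner_basis_apply hT, norm_mul, RCLike.norm_ofReal, mul_pow, sq_abs]

theorem isSymmetric_of_apply_basis (hT : ∀ i, T (b i) = (d i : 𝕜) • b i) : T.IsSymmetric := by
  intro x y
  rw [← b.sum_inner_mul_inner, ← b.sum_inner_mul_inner x]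
  refine Finset.sum_congr rfl fun i _ => ?_
  rw [← inner_conj_symm, inner_basis_apply hT, inner_basis_apply hT, map_mul, RCLike.conj_ofReal,
    inner_conj_symm]
  ring

theorem det_of_apply_basis (hT : ∀ i, T (b i) = (d i : 𝕜) • b i) :
    LinearMap.det T = ((∏ i, d i : ℝ) : 𝕜) := by
  classical
  have h : LinearMap.toMatrix b.toBasis b.toBasis T = Matrix.diagonal fun i => (d i : 𝕜) := by
    ext i j
    rw [LinearMap.toMatrix_apply, b.coe_toBasis, hT, Matrix.diagonal_apply]
    by_cases hij : i = j
    · subst hij; simp [RCLike.real_smul_eq_coe_mul]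
    · simp [hij]
  rw [← LinearMap.det_toMatrix b.toBasis, h, Matrix.det_diagonal]
  push_cast
  rfl

theorem injective_of_apply_basis (hT : ∀ i, T (b i) = (d i : 𝕜) • b i) (hd : ∀ i, d i ≠ 0) :
    Function.Injective T := by
  rw [injective_iff_map_eq_zero]
  intro x hx
  refine b.toBasis.ext_elem fun i => ?_
  have := inner_basis_apply hT i x
  rw [hx, inner_zero_right, eq_comm, mul_eq_zero] at this
  simpa [hd i, b.repr_apply_apply] using this

end Diagonal

section Shift

variable {𝕜 E : Type*} [RCLike 𝕜] [NormedAddCommGroup E] [InnerProductSpace 𝕜 E]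
  {T : E →ₗ[𝕜] E}

local notation "⟪" x ", " y "⟫" => inner 𝕜 x y

theorem isSymmetric_sub_smul_id (hT : T.IsSymmetric) (c : ℝ) :
    (T - (c : 𝕜) • (LinearMap.id : E →ₗ[𝕜] E)).IsSymmetric := by
  intro x y
  simp [inner_sub_left, inner_sub_right, inner_smul_left, inner_smul_right, hT x y]

theorem re_inner_sub_smul_id (T : E →ₗ[𝕜] E) (c : ℝ) (x : E) :
    RCLike.re ⟪(T - (c : 𝕜) • (LinearMap.id : E →ₗ[𝕜] E)) x, x⟫ = RCLike.re ⟪T x, x⟫ - c * ‖x‖ ^ 2 := by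
  simp only [LinearMap.sub_apply, LinearMap.smul_apply, LinearMap.id_apply, inner_sub_left,
    inner_smul_left, RCLike.conj_ofReal, map_sub, RCLike.re_ofReal_mul, inner_self_eq_norm_sq]

end Shift

/-! ### Comparison of eigenvalues -/

section Eigenvalues

variable {𝕜 E F : Type*} [RCLike 𝕜] [NormedAddCommGroup E] [InnerProductSpace 𝕜 E]
  [FiniteDimensional 𝕜 E] [NormedAddCommGroup F] [InnerProductSpace 𝕜 F] [FiniteDimensional 𝕜 F]

local notation "⟪" x ", " y "⟫" => inner 𝕜 x y

/-- The Courant-Fischer principle in the form of a comparison of two Hermitian operators. The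
span of the eigenvectors of `M` for its `i + 1` largest eigenvalues is carried by `S` to a subspace
that meets the span of the eigenvectors of `N` for its eigenvalues with index at least `i`. -/
theorem le_eigenvalues_of_injective {M : E →ₗ[𝕜] E} {N : F →ₗ[𝕜] F} (hM : M.IsSymmetric)
    (hN : N.IsSymmetric) {m n : ℕ} (hm : Module.finrank 𝕜 E = m) (hn : Module.finrank 𝕜 F = n)
    (S : E →ₗ[𝕜] F) (hS : Function.Injective S) (i : Fin m) (j : Fin n) (hij : (i : ℕ) = j) (c : ℝ)
    (h : ∀ v, hM.eigenvalues hm i * ‖v‖ ^ 2 ≤ RCLike.re ⟪M v, v⟫ →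
      c * ‖S v‖ ^ 2 ≤ RCLike.re ⟪N (S v), S v⟫) :
    c ≤ hN.eigenvalues hn j := by
  set e := hM.eigenvectorBasis hm
  set f := hN.eigenvectorBasis hn
  let g : Fin (i + 1) → Fin m := Fin.castLE i.2
  let L : (Fin (i + 1) → 𝕜) →ₗ[𝕜] E := Fintype.linearCombination 𝕜 (e ∘ g)
  let G : F →ₗ[𝕜] (Fin j → 𝕜) :=
    LinearMap.pi fun k => (innerSL 𝕜 (f (Fin.castLE j.2.le k))).toLinearMap
  obtain ⟨a, ha, ha0⟩ : ∃ a ∈ LinearMap.ker (G ∘ₗ S ∘ₗ L), a ≠ 0 := by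
    refine (Submodule.ne_bot_iff _).1 (LinearMap.ker_ne_bot_of_finrank_lt ?_)
    simp [hij]
  have hL : Function.Injective L :=
    LinearIndependent.fintypeLinearCombination_injective
      (e.orthonormal.linearIndependent.comp g (Fin.castLE_injective _))
  have hLa : L a = ∑ k, a k • e (g k) := Fintype.linearCombination_apply 𝕜 _ _
  have hw0 : S (L a) ≠ 0 := fun h0 => ha0 (hL (hS (by simpa using h0)))
  have hlow : ∀ k, i < k → ⟪e k, L a⟫ = 0 := by
    intro k hk
    rw [hLa, inner_sum]
    refine Finset.sum_eq_zero fun l _ => ?_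
    rw [inner_smul_right, e.inner_eq_zero, mul_zero]
    intro hkl
    have := l.2
    have : (k : ℕ) = l := congrArg Fin.val hkl
    omega
  have hhigh : ∀ k, k < j → ⟪f k, S (L a)⟫ = 0 := fun k hk =>
    congrFun (LinearMap.mem_ker.1 ha) ⟨k, hk⟩
  have h1 := h (L a) (by
    rw [re_inner_apply_self (hM.apply_eigenvectorBasis hm), ← e.sum_sq_norm_inner_right,
      Finset.mul_sum]
    refine Finset.sum_le_sum fun k _ => ?_
    rcases le_or_gt k i with hk | hk
    · exact mul_le_mul_of_nonneg_right (hM.eigenvalues_antitone hm hk) (sq_nonneg _)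
    · simp [e, hlow k hk])
  have h2 : RCLike.re ⟪N (S (L a)), S (L a)⟫ ≤ hN.eigenvalues hn j * ‖S (L a)‖ ^ 2 := by
    rw [re_inner_apply_self (hN.apply_eigenvectorBasis hn), ← f.sum_sq_norm_inner_right,
      Finset.mul_sum]
    refine Finset.sum_le_sum fun k _ => ?_
    rcases lt_or_ge k j with hk | hk
    · simp [f, hhigh k hk]
    · exact mul_le_mul_of_nonneg_right (hN.eigenvalues_antitone hn hk) (sq_nonneg _)
  exact le_of_mul_le_mul_right (h1.trans h2) (by positivity)

theorem eigenvalues_sub_smul_id {T : E →ₗ[𝕜] E} (hT : T.IsSymmetric) {n : ℕ}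
    (hn : Module.finrank 𝕜 E = n) (c : ℝ) (i : Fin n) :
    (isSymmetric_sub_smul_id hT c).eigenvalues hn i = hT.eigenvalues hn i - c := by
  apply le_antisymm
  · rw [le_sub_iff_add_le]
    refine le_eigenvalues_of_injective (isSymmetric_sub_smul_id hT c) hT hn hn LinearMap.id
      Function.injective_id i i rfl _ fun v hv => ?_
    rw [re_inner_sub_smul_id] at hv
    rw [LinearMap.id_apply]
    linarith
  · refine le_eigenvalues_of_injective hT (isSymmetric_sub_smul_id hT c) hn hn LinearMap.id
      Function.injective_id i i rfl _ fun v hv => ?_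
    rw [LinearMap.id_apply, re_inner_sub_smul_id]
    linarith

theorem mul_norm_sq_le_re_inner {T : E →ₗ[𝕜] E} (hT : T.IsSymmetric) {n : ℕ}
    (hn : Module.finrank 𝕜 E = n) {c : ℝ} (hc : ∀ i, c ≤ hT.eigenvalues hn i) (x : E) :
    c * ‖x‖ ^ 2 ≤ RCLike.re ⟪T x, x⟫ := by
  rw [re_inner_apply_self (hT.apply_eigenvectorBasis hn),
    ← (hT.eigenvectorBasis hn).sum_sq_norm_inner_right, Finset.mul_sum]
  exact Finset.sum_le_sum fun i _ => mul_le_mul_of_nonneg_right (hc i) (sq_nonneg _)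

theorem prod_eigenvalues_eq_of_det_eq {T : E →ₗ[𝕜] E} (hT : T.IsSymmetric) {n : ℕ}
    (hn : Module.finrank 𝕜 E = n) {r : ℝ} (h : LinearMap.det T = (r : 𝕜)) :
    ∏ i, hT.eigenvalues hn i = r := by
  rw [hT.det_eq_prod_eigenvalues hn] at h
  exact_mod_cast h

end Eigenvalues

/-! ### Weak majorization -/

section Majorization

variable {n : ℕ}

theorem decreasing_antitone (x : Fin n → ℝ) : Antitone (decreasing x) := fun _ _ h =>
  Tuple.monotone_sort x (Fin.rev_le_rev.2 h)

theorem decreasing_eq_self {x : Fin n → ℝ} (hx : Antitone x) : decreasing x = x := by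
  have h : x ∘ Fin.revPerm = x ∘ Tuple.sort x :=
    Tuple.comp_sort_eq_comp_iff_monotone.2 fun i j hij => hx (Fin.rev_le_rev.2 hij)
  funext i
  simpa [decreasing] using (congrFun h (Fin.rev i)).symm

theorem decreasing_comp {f : ℝ → ℝ} (hf : Monotone f) (x : Fin n → ℝ) (i : Fin n) :
    decreasing (fun j => f (x j)) i = f (decreasing x i) := by
  have h : (f ∘ x) ∘ Tuple.sort x = (f ∘ x) ∘ Tuple.sort (f ∘ x) :=
    Tuple.comp_sort_eq_comp_iff_monotone.2 (hf.comp (Tuple.monotone_sort x))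
  exact (congrFun h (Fin.rev i)).symm

/-- Weak majorization by a decreasing vector only has to be tested on the sums over all subsets,
since the `k` largest entries of `x` are the entries of `x` on some subset of `k` indices. -/
theorem weaklyMajorizedBy_of_forall_finset {x y : Fin n → ℝ} (hy : Antitone y)
    (h : ∀ I : Finset (Fin n), ∀ hk : I.card ≤ n,
      ∑ i ∈ I, x i ≤ ∑ i : Fin I.card, y (Fin.castLE hk i)) :
    WeaklyMajorizedBy x y := by
  intro k _ hk
  rw [decreasing_eq_self hy]
  let g : Fin k ↪ Fin n :=
    ⟨fun i => Tuple.sort x (Fin.rev (Fin.castLE hk i)), fun i j hij =>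
      Fin.castLE_injective hk (Fin.rev_injective ((Tuple.sort x).injective hij))⟩
  have hc : (Finset.univ.map g).card = k := by simp
  have := h (Finset.univ.map g) (by rw [hc]; exact hk)
  rw [Finset.sum_map] at this
  refine this.trans_eq ?_
  generalize hq : (Finset.univ.map g).card = q at *
  subst hc
  rfl

/-- Summation by parts: the weighted partial sums dominate the plain ones, scaled by the smallest
weight. -/
theorem mul_sum_le_sum_mul {w d : Fin n → ℝ} (hw : Antitone w)
    (hd : ∀ k : ℕ, 1 ≤ k → ∀ hk : k ≤ n, 0 ≤ ∑ i : Fin k, d (Fin.castLE hk i)) :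
    ∀ (k : ℕ) (hk : k < n), w ⟨k, hk⟩ * ∑ i : Fin (k + 1), d (Fin.castLE hk i) ≤
      ∑ i : Fin (k + 1), w (Fin.castLE hk i) * d (Fin.castLE hk i) := by
  intro k
  induction k with
  | zero =>
    intro hk
    rw [Fin.sum_univ_one, Fin.sum_univ_one]
    rfl
  | succ k ih =>
    intro hk
    have h1 := ih (by omega)
    have h2 := hd (k + 1) (by omega) (by omega)
    have h3 : w ⟨k + 1, hk⟩ ≤ w ⟨k, by omega⟩ := hw (by simp)
    rw [Fin.sum_univ_castSucc, Fin.sum_univ_castSucc (n := k + 1), mul_add]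
    exact add_le_add ((mul_le_mul_of_nonneg_right h3 h2).trans h1) le_rfl

/-- Weak majorization is preserved by the increasing convex function `t ↦ exp t - 1`: the tangents
to `exp` at the entries of `x↓` have decreasing positive slopes. -/
theorem WeaklyMajorizedBy.exp_sub_one {x y : Fin n → ℝ} (h : WeaklyMajorizedBy x y) :
    WeaklyMajorizedBy (fun i => Real.exp (x i) - 1) (fun i => Real.exp (y i) - 1) := by
  have hmono : Monotone fun t : ℝ => Real.exp t - 1 := fun a b hab =>
    sub_le_sub_right (Real.exp_le_exp.2 hab) 1
  intro k hk1 hk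
  simp only [decreasing_comp hmono]
  obtain ⟨k, rfl⟩ : ∃ l, k = l + 1 := ⟨k - 1, by omega⟩
  have key := mul_sum_le_sum_mul (w := fun i => Real.exp (decreasing x i))
    (d := fun i => decreasing y i - decreasing x i)
    (fun i j hij => Real.exp_le_exp.2 (decreasing_antitone x hij))
    (fun l hl1 hl => by
      rw [Finset.sum_sub_distrib]
      exact sub_nonneg.2 (h l hl1 hl)) k hk
  have h0 : 0 ≤ ∑ i : Fin (k + 1), (decreasing y (Fin.castLE hk i) -
      decreasing x (Fin.castLE hk i)) := by
    rw [Finset.sum_sub_distrib]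
    exact sub_nonneg.2 (h (k + 1) hk1 hk)
  have h1 := (mul_nonneg (Real.exp_pos (decreasing x ⟨k, hk⟩)).le h0).trans key
  rw [← sub_nonneg, ← Finset.sum_sub_distrib]
  refine h1.trans (Finset.sum_le_sum fun i _ => ?_)
  have h2 := mul_le_mul_of_nonneg_left
    (Real.add_one_le_exp (decreasing y (Fin.castLE hk i) - decreasing x (Fin.castLE hk i)))
    (Real.exp_pos (decreasing x (Fin.castLE hk i))).le
  rw [← Real.exp_add, add_sub_cancel] at h2
  linarith

end Majorization

/-! ### The multiplicative Lidskii inequality -/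

section Lidskii

variable {𝕜 E F : Type*} [RCLike 𝕜] [NormedAddCommGroup E] [InnerProductSpace 𝕜 E]
  [FiniteDimensional 𝕜 E] [NormedAddCommGroup F] [InnerProductSpace 𝕜 F] [FiniteDimensional 𝕜 F]

local notation "⟪" x ", " y "⟫" => inner 𝕜 x y

/-- Truncating the eigenvalues of `C = K K*` at a level `s`. If `R` is the square root of the
truncation `min(C, s)`, then the eigenvalues `μ` of `R B R` lie below those of `N`, because
`min(C, s) ≤ C`, and below `s` times those of `B`, because `min(C, s) ≤ s`; and their product is the
determinant of `R B R`. -/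
theorem exists_truncation {B C : E →ₗ[𝕜] E} {N : F →ₗ[𝕜] F} (hB : B.IsSymmetric)
    (hC : C.IsSymmetric) (hN : N.IsSymmetric) {p : ℕ} (hE : Module.finrank 𝕜 E = p)
    (hF : Module.finrank 𝕜 F = p) (K : F →ₗ[𝕜] E) (hCK : C = K ∘ₗ LinearMap.adjoint K)
    (hBpos : ∀ i, 0 < hB.eigenvalues hE i) (hCpos : ∀ i, 0 < hC.eigenvalues hE i)
    (hBN : ∀ y, RCLike.re ⟪B (K y), K y⟫ ≤ RCLike.re ⟪N y, y⟫) {s : ℝ} (hs : 0 < s) :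
    ∃ μ : Fin p → ℝ, (∀ i, 0 < μ i) ∧ (∀ i, μ i ≤ hN.eigenvalues hF i) ∧
      (∀ i, μ i ≤ s * hB.eigenvalues hE i) ∧
      ∏ i, μ i = (∏ i, min (hC.eigenvalues hE i) s) * ∏ i, hB.eigenvalues hE i := by
  set γ := hC.eigenvalues hE with hγ
  set v := hC.eigenvectorBasis hE
  have hCv : ∀ i, C (v i) = (γ i : 𝕜) • v i := hC.apply_eigenvectorBasis hE
  let r : Fin p → ℝ := fun i => √(min (γ i) s)
  have hr2 : ∀ i, r i ^ 2 = min (γ i) s := fun i => Real.sq_sqrt (lt_min (hCpos i) hs).le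
  have hr0 : ∀ i, 0 < r i := fun i => Real.sqrt_pos.2 (lt_min (hCpos i) hs)
  set R := diagonalOperator v r
  have hR := diagonalOperator_apply_basis v r
  have hRs : R.IsSymmetric := isSymmetric_of_apply_basis hR
  have hRinj : Function.Injective R := injective_of_apply_basis hR fun i => (hr0 i).ne'
  -- `U` is `C⁻¹ R`, so that `S = K* U` satisfies `K S = R` and `S* S = R C⁻¹ R ≤ 1`.
  set U := diagonalOperator v fun i => r i / γ i
  have hU := diagonalOperator_apply_basis v fun i => r i / γ i
  have hCU : ∀ x, C (U x) = R x := fun x => by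
    refine v.toBasis.ext_elem fun i => ?_
    have h1 := inner_basis_apply hCv i (U x)
    rw [inner_basis_apply hU, ← mul_assoc, ← RCLike.ofReal_mul,
      mul_div_cancel₀ _ (hCpos i).ne', ← inner_basis_apply hR] at h1
    simpa [v.repr_apply_apply] using h1
  have hM : (R ∘ₗ B ∘ₗ R).IsSymmetric := fun x y => by
    simp only [LinearMap.comp_apply]
    rw [hRs, hB, hRs]
  have hMr : ∀ x, RCLike.re ⟪(R ∘ₗ B ∘ₗ R) x, x⟫ = RCLike.re ⟪B (R x), R x⟫ := fun x => by
    simp only [LinearMap.comp_apply]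
    rw [hRs]
  have hRn : ∀ x, ‖R x‖ ^ 2 ≤ s * ‖x‖ ^ 2 := fun x => by
    rw [norm_sq_apply hR, ← v.sum_sq_norm_inner_right, Finset.mul_sum]
    refine Finset.sum_le_sum fun i _ => mul_le_mul_of_nonneg_right ?_ (sq_nonneg _)
    rw [hr2]
    exact min_le_right _ _
  have hprod : ∏ i, hM.eigenvalues hE i =
      (∏ i, min (γ i) s) * ∏ i, hB.eigenvalues hE i := by
    refine prod_eigenvalues_eq_of_det_eq hM hE ?_
    rw [LinearMap.det_comp, LinearMap.det_comp, det_of_apply_basis hR,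
      hB.det_eq_prod_eigenvalues hE, ← RCLike.ofReal_prod, ← RCLike.ofReal_mul,
      ← RCLike.ofReal_mul]
    congr 1
    rw [← Finset.prod_congr rfl fun i _ => hr2 i, Finset.prod_pow]
    ring
  have hnn : ∀ i, 0 ≤ hM.eigenvalues hE i := fun i => by
    refine le_eigenvalues_of_injective hM hM hE hE LinearMap.id Function.injective_id i i rfl _
      fun x _ => ?_
    rw [LinearMap.id_apply, hMr]
    have := mul_norm_sq_le_re_inner hB hE (fun i => (hBpos i).le) (R x)
    linarith
  have hpos : ∀ i, 0 < hM.eigenvalues hE i := fun i => by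
    refine lt_of_le_of_ne (hnn i) fun h0 => ?_
    have h1 : ∏ i, hM.eigenvalues hE i = 0 := Finset.prod_eq_zero (Finset.mem_univ i) h0.symm
    rw [hprod] at h1
    exact (mul_pos (Finset.prod_pos fun i _ => lt_min (hCpos i) hs)
      (Finset.prod_pos fun i _ => hBpos i)).ne' h1
  refine ⟨hM.eigenvalues hE, hpos, fun i => ?_, fun i => ?_, hprod⟩
  · have hKU : ∀ x, K ((LinearMap.adjoint K ∘ₗ U) x) = R x := fun x => by
      rw [← hCU, hCK]
      rfl
    refine le_eigenvalues_of_injective hM hN hE hF (LinearMap.adjoint K ∘ₗ U)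
      (fun x y hxy => hRinj (by rw [← hKU, ← hKU, hxy])) i i rfl _ fun x hx => ?_
    refine le_trans ?_ (hBN _)
    rw [hKU, ← hMr]
    refine le_trans (mul_le_mul_of_nonneg_left ?_ (hnn i)) hx
    have h1 : ‖(LinearMap.adjoint K ∘ₗ U) x‖ ^ 2 = RCLike.re ⟪C (U x), U x⟫ := by
      rw [hCK, LinearMap.comp_apply, LinearMap.comp_apply, ← inner_self_eq_norm_sq (𝕜 := 𝕜),
        LinearMap.adjoint_inner_right]
    rw [h1, re_inner_apply_self hCv, ← v.sum_sq_norm_inner_right]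
    refine Finset.sum_le_sum fun j _ => ?_
    have hj := hCpos j
    rw [inner_basis_apply hU, norm_mul, RCLike.norm_ofReal, mul_pow, sq_abs, div_pow, hr2,
      ← mul_assoc]
    refine mul_le_of_le_one_left (sq_nonneg _) ?_
    rw [mul_div_assoc', div_le_one (by positivity), sq]
    exact mul_le_mul_of_nonneg_left (min_le_left _ _) hj.le
  · rw [← div_le_iff₀' hs]
    refine le_eigenvalues_of_injective hM hB hE hE R hRinj i i rfl _ fun x hx => ?_
    rw [← hMr]
    refine le_trans ?_ hx
    rw [div_mul_eq_mul_div, div_le_iff₀ hs, mul_assoc]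
    exact mul_le_mul_of_nonneg_left ((hRn x).trans_eq (mul_comm _ _)) (hnn i)

/-- The multiplicative Lidskii inequality (Gelfand-Naimark), with `N ≥ K* B K` in place of equality.
Every factor `s * β i / μ i` obtained from the truncation at `s`, the `k`-th smallest eigenvalue of
`C`, is at least `1`, so the product over the `k` indices in `I` is at most the product over all
indices, a quotient of determinants in which only the `k` smallest eigenvalues of `C` survive. -/
theorem sum_log_div_le {B C : E →ₗ[𝕜] E} {N : F →ₗ[𝕜] F} (hB : B.IsSymmetric)
    (hC : C.IsSymmetric) (hN : N.IsSymmetric) {p : ℕ} (hE : Module.finrank 𝕜 E = p)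
    (hF : Module.finrank 𝕜 F = p) (K : F →ₗ[𝕜] E) (hCK : C = K ∘ₗ LinearMap.adjoint K)
    (hBpos : ∀ i, 0 < hB.eigenvalues hE i) (hCpos : ∀ i, 0 < hC.eigenvalues hE i)
    (hBN : ∀ y, RCLike.re ⟪B (K y), K y⟫ ≤ RCLike.re ⟪N y, y⟫)
    (I : Finset (Fin p)) (hI : I.card ≤ p) :
    ∑ i ∈ I, Real.log (hB.eigenvalues hE i / hN.eigenvalues hF i) ≤
      ∑ i : Fin I.card, -Real.log (hC.eigenvalues hE (Fin.rev (Fin.castLE hI i))) := by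
  rcases I.eq_empty_or_nonempty with rfl | hne
  · rw [Finset.sum_empty]
    exact (Fin.sum_univ_zero _).ge
  have hk : 0 < I.card := hne.card_pos
  set γ := hC.eigenvalues hE
  set s := γ (Fin.rev ⟨I.card - 1, by omega⟩) with hs_def
  have hs : 0 < s := hCpos _
  obtain ⟨μ, hμ0, hμN, hμB, hprod⟩ :=
    exists_truncation hB hC hN hE hF K hCK hBpos hCpos hBN hs
  set β := hB.eigenvalues hE
  have hterm : ∀ i, 0 ≤ Real.log (s * β i / μ i) := fun i =>
    Real.log_nonneg ((one_le_div (hμ0 i)).2 (hμB i))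
  have hexp : ∀ i, Real.log (s * β i / μ i) = Real.log s + Real.log (β i) - Real.log (μ i) :=
    fun i => by
      rw [Real.log_div (mul_pos hs (hBpos i)).ne' (hμ0 i).ne',
        Real.log_mul hs.ne' (hBpos i).ne']
  have hlogprod : ∑ i, Real.log (μ i) =
      ∑ i, Real.log (min (γ i) s) + ∑ i, Real.log (β i) := by
    have hmin : ∀ i, min (γ i) s ≠ 0 := fun i => (lt_min (hCpos i) hs).ne'
    rw [← Real.log_prod fun i _ => (hμ0 i).ne', hprod,
      Real.log_mul (Finset.prod_ne_zero_iff.2 fun i _ => hmin i)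
        (Finset.prod_ne_zero_iff.2 fun i _ => (hBpos i).ne'),
      Real.log_prod fun i _ => hmin i, Real.log_prod fun i _ => (hBpos i).ne']
  -- The terms of the `p - k` largest eigenvalues of `C` vanish, since these are at least `s`.
  have hsplit : ∑ i, (Real.log s - Real.log (min (γ i) s)) =
      ∑ i : Fin I.card, (Real.log s - Real.log (γ (Fin.rev (Fin.castLE hI i)))) := by
    rw [← Equiv.sum_comp Fin.revPerm]
    have hinj := Fin.castLE_injective hI
    rw [← Finset.sum_subset (Finset.subset_univ (Finset.univ.map ⟨_, hinj⟩)), Finset.sum_map]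
    · refine Finset.sum_congr rfl fun i _ => ?_
      have : γ (Fin.rev (Fin.castLE hI i)) ≤ s := hC.eigenvalues_antitone hE
        (Fin.rev_le_rev.2 (Fin.le_def.2 (Nat.le_sub_one_of_lt i.2)))
      simp [min_eq_left this]
    · intro i _ hi
      have hle : I.card ≤ i := by
        by_contra hlt
        exact hi (Finset.mem_map.2 ⟨⟨i, not_le.1 hlt⟩, Finset.mem_univ _, rfl⟩)
      have : s ≤ γ (Fin.rev i) := hC.eigenvalues_antitone hE
        (Fin.rev_le_rev.2 (Fin.le_def.2 (by simp only; omega)))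
      simp [min_eq_right this]
  calc ∑ i ∈ I, Real.log (β i / hN.eigenvalues hF i)
      ≤ ∑ i ∈ I, (Real.log (s * β i / μ i) - Real.log s) := by
        refine Finset.sum_le_sum fun i _ => ?_
        rw [hexp, Real.log_div (hBpos i).ne' ((hμ0 i).trans_le (hμN i)).ne']
        have := Real.log_le_log (hμ0 i) (hμN i)
        linarith
    _ = ∑ i ∈ I, Real.log (s * β i / μ i) - I.card * Real.log s := by
        rw [Finset.sum_sub_distrib, Finset.sum_const, nsmul_eq_mul]
    _ ≤ ∑ i, Real.log (s * β i / μ i) - I.card * Real.log s :=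
        sub_le_sub_right (Finset.sum_le_sum_of_subset_of_nonneg (Finset.subset_univ I)
          fun i _ _ => hterm i) _
    _ = ∑ i, (Real.log s - Real.log (min (γ i) s)) - I.card * Real.log s := by
        simp only [hexp, Finset.sum_sub_distrib, Finset.sum_add_distrib, hlogprod]
        ring
    _ = ∑ i : Fin I.card, -Real.log (γ (Fin.rev (Fin.castLE hI i))) := by
        rw [hsplit, Finset.sum_sub_distrib, Finset.sum_const, Finset.sum_neg_distrib]
        simp

end Lidskii

/-! ### Ritz values and principal angles -/

section Ritz

variable {𝕜 H : Type*} [RCLike 𝕜] [NormedAddCommGroup H] [InnerProductSpace 𝕜 H]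
  [FiniteDimensional 𝕜 H]

local notation "⟪" x ", " y "⟫" => inner 𝕜 x y

theorem inner_rayleighRitz_apply (A : H →ₗ[𝕜] H) (X : Submodule 𝕜 H) (x y : X) :
    ⟪rayleighRitz A X x, y⟫ = ⟪A x, (y : H)⟫ := by
  simp only [rayleighRitz, LinearMap.comp_apply, Submodule.subtype_apply,
    ContinuousLinearMap.coe_coe]
  rw [Submodule.inner_orthogonalProjectionOnto_eq_of_mem_right]

theorem minRitzValue_mul_norm_sq_le {A : H →ₗ[𝕜] H} (hA : A.IsSymmetric) {Z : Submodule 𝕜 H}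
    {z : H} (hz : z ∈ Z) : minRitzValue hA Z * ‖z‖ ^ 2 ≤ RCLike.re ⟪A z, z⟫ := by
  have h := mul_norm_sq_le_re_inner (rayleighRitz_isSymmetric hA Z) rfl
    (c := minRitzValue hA Z) (fun i => ciInf_le (Set.finite_range _).bddBelow i) ⟨z, hz⟩
  rwa [inner_rayleighRitz_apply] at h

theorem rayleighRitz_starProjection_eq (X Y : Submodule 𝕜 H) :
    rayleighRitz Y.starProjection.toLinearMap X =
      (X.orthogonalProjectionOnto.toLinearMap ∘ₗ Y.subtype) ∘ₗ
        LinearMap.adjoint (X.orthogonalProjectionOnto.toLinearMap ∘ₗ Y.subtype) := by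
  have h : Y.orthogonalProjectionOnto.toLinearMap ∘ₗ X.subtype =
      LinearMap.adjoint (X.orthogonalProjectionOnto.toLinearMap ∘ₗ Y.subtype) := by
    rw [LinearMap.eq_adjoint_iff]
    intro x y
    simp only [LinearMap.comp_apply, Submodule.subtype_apply, ContinuousLinearMap.coe_coe]
    rw [Submodule.inner_orthogonalProjectionOnto_eq_of_mem_right,
      Submodule.inner_orthogonalProjectionOnto_eq_of_mem_left]
  rw [← h]
  rfl

/-- The component of `y` orthogonal to the invariant subspace `X` lies in `X ⊔ Y`, does not
interact with the component in `X`, and contributes nonnegatively to the shifted quadratic form. -/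
theorem re_inner_orthogonalProjection_le {A : H →ₗ[𝕜] H} (hA : A.IsSymmetric)
    {X Y : Submodule 𝕜 H} (hX : ∀ x ∈ X, A x ∈ X) {y : H} (hy : y ∈ Y) :
    RCLike.re ⟪A (X.starProjection y), X.starProjection y⟫ -
        minRitzValue hA (X ⊔ Y) * ‖X.starProjection y‖ ^ 2 ≤
      RCLike.re ⟪A y, y⟫ - minRitzValue hA (X ⊔ Y) * ‖y‖ ^ 2 := by
  set x := X.starProjection y with hx
  have hxX : x ∈ X := X.starProjection_apply_mem y
  set z := y - x with hz
  have hzX : z ∈ Xᗮ := X.sub_starProjection_mem_orthogonal y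
  have hzZ : z ∈ X ⊔ Y :=
    Submodule.sub_mem _ (Submodule.mem_sup_right hy) (Submodule.mem_sup_left hxX)
  have hmin := minRitzValue_mul_norm_sq_le hA hzZ
  have hxz : ⟪x, z⟫ = 0 := X.inner_right_of_mem_orthogonal hxX hzX
  have hAxz : ⟪A x, z⟫ = 0 := X.inner_right_of_mem_orthogonal (hX x hxX) hzX
  have hAzx : ⟪A z, x⟫ = 0 := by
    rw [hA z x]
    exact X.inner_left_of_mem_orthogonal (hX x hxX) hzX
  have hyz : y = x + z := by rw [hz]; abel
  have hn : ‖y‖ ^ 2 = ‖x‖ ^ 2 + ‖z‖ ^ 2 := by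
    rw [hyz, sq, sq, sq]
    exact norm_add_sq_eq_norm_sq_add_norm_sq_of_inner_eq_zero (𝕜 := 𝕜) x z hxz
  have hq : RCLike.re ⟪A y, y⟫ = RCLike.re ⟪A x, x⟫ + RCLike.re ⟪A z, z⟫ := by
    rw [hyz, map_add, inner_add_left, inner_add_right, inner_add_right, hAxz, hAzx]
    simp
  rw [hn, hq]
  linarith

/-- Cauchy interlacing: no subspace has larger Ritz values than the dominant invariant one. -/
theorem ritzValues_le_of_isTopInvariant {A : H →ₗ[𝕜] H} (hA : A.IsSymmetric)
    {X Y : Submodule 𝕜 H} {p : ℕ} (hXp : Module.finrank 𝕜 X = p) (hYp : Module.finrank 𝕜 Y = p)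
    (hX : IsTopInvariant hA X) (i : Fin p) : ritzValues hA Y hYp i ≤ ritzValues hA X hXp i := by
  subst hXp
  rw [hX.2 i]
  refine le_eigenvalues_of_injective (rayleighRitz_isSymmetric hA Y) hA hYp rfl Y.subtype
    Y.subtype_injective i _ rfl _ fun y hy => ?_
  rwa [inner_rayleighRitz_apply] at hy

theorem ritzValues_starProjection_le_one (X Y : Submodule 𝕜 H) {p : ℕ}
    (hp : Module.finrank 𝕜 X = p) (i : Fin p) :
    ritzValues (A := Y.starProjection.toLinearMap) Y.starProjection_isSymmetric X hp i ≤ 1 := by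
  set T := rayleighRitz Y.starProjection.toLinearMap X
  have hT : T.IsSymmetric := rayleighRitz_isSymmetric Y.starProjection_isSymmetric X
  set v := hT.eigenvectorBasis hp i
  have hv : ‖v‖ = 1 := (hT.eigenvectorBasis hp).norm_eq_one i
  have h1 : RCLike.re ⟪T v, v⟫ = hT.eigenvalues hp i := by
    rw [hT.apply_eigenvectorBasis hp, inner_smul_left, inner_self_eq_norm_sq_to_K, hv]
    simp
  rw [inner_rayleighRitz_apply] at h1
  refine h1.symm.trans_le ((RCLike.re_le_norm _).trans ((norm_inner_le_norm _ _).trans ?_))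
  have h2 := Y.norm_starProjection_apply_le (v : H)
  have h3 : ‖(v : H)‖ = 1 := hv
  rw [h3] at h2 ⊢
  simpa using h2

theorem ritzValues_starProjection_pos {X Y : Submodule 𝕜 H} {p : ℕ}
    {hp : Module.finrank 𝕜 X = p} (h : ∀ i, principalAngles X Y hp i < Real.pi / 2) (i : Fin p) :
    0 < ritzValues (A := Y.starProjection.toLinearMap) Y.starProjection_isSymmetric X hp i := by
  have := h (Fin.rev i)
  rw [principalAngles, Real.arccos_lt_pi_div_two, Real.sqrt_pos, Fin.rev_rev] at this
  exact this

theorem one_add_tan_sq_principalAngles {X Y : Submodule 𝕜 H} {p : ℕ}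
    {hp : Module.finrank 𝕜 X = p} (h : ∀ i, principalAngles X Y hp i < Real.pi / 2) (i : Fin p) :
    1 + Real.tan (principalAngles X Y hp i) ^ 2 =
      (ritzValues (A := Y.starProjection.toLinearMap) Y.starProjection_isSymmetric X hp
        (Fin.rev i))⁻¹ := by
  have hpos := ritzValues_starProjection_pos h (Fin.rev i)
  have hle := ritzValues_starProjection_le_one X Y hp (Fin.rev i)
  have hcos : Real.cos (principalAngles X Y hp i) = √(ritzValues
      (A := Y.starProjection.toLinearMap) Y.starProjection_isSymmetric X hp (Fin.rev i)) :=
    Real.cos_arccos (by linarith [Real.sqrt_nonneg (ritzValues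
      (A := Y.starProjection.toLinearMap) Y.starProjection_isSymmetric X hp (Fin.rev i))])
      (Real.sqrt_le_one.2 hle)
  have hcos0 : Real.cos (principalAngles X Y hp i) ≠ 0 := by
    rw [hcos]
    exact (Real.sqrt_pos.2 hpos).ne'
  rw [← inv_inj, Real.inv_one_add_tan_sq hcos0, hcos, Real.sq_sqrt hpos.le, inv_inv]

end Ritz

end RitzMajorization

end

open RitzMajorization in
theorem theorem2p4 {𝕜 H : Type*} [RCLike 𝕜] [NormedAddCommGroup H] [InnerProductSpace 𝕜 H]
    [FiniteDimensional 𝕜 H] (A : H →ₗ[𝕜] H) (hA : A.IsSymmetric) (X Y : Submodule 𝕜 H) (p : ℕ)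
    (hXp : Module.finrank 𝕜 X = p) (hYp : Module.finrank 𝕜 Y = p)
    (hX : IsTopInvariant hA X)
    (hangle : ∀ i, principalAngles X Y hXp i < Real.pi / 2)
    (hmin : ∀ i, minRitzValue hA (X ⊔ Y) < ritzValues hA X hXp i) :
    (∀ i, minRitzValue hA (X ⊔ Y) < ritzValues hA Y hYp i) ∧
    (∀ i, 0 ≤ Real.log ((ritzValues hA X hXp i - minRitzValue hA (X ⊔ Y)) /
      (ritzValues hA Y hYp i - minRitzValue hA (X ⊔ Y)))) ∧
    WeaklyMajorizedBy
      (fun i => Real.log ((ritzValues hA X hXp i - minRitzValue hA (X ⊔ Y)) /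
        (ritzValues hA Y hYp i - minRitzValue hA (X ⊔ Y))))
      (fun i => Real.log (1 + Real.tan (principalAngles X Y hXp i) ^ 2)) ∧
    (∀ i, 0 ≤ (ritzValues hA X hXp i - ritzValues hA Y hYp i) /
      (ritzValues hA Y hYp i - minRitzValue hA (X ⊔ Y))) ∧
    WeaklyMajorizedBy
      (fun i => (ritzValues hA X hXp i - ritzValues hA Y hYp i) /
        (ritzValues hA Y hYp i - minRitzValue hA (X ⊔ Y)))
      (fun i => Real.tan (principalAngles X Y hXp i) ^ 2) := by
  set c := minRitzValue hA (X ⊔ Y) with hc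
  have hAX := rayleighRitz_isSymmetric hA X
  have hAY := rayleighRitz_isSymmetric hA Y
  have hB := isSymmetric_sub_smul_id hAX c
  have hN := isSymmetric_sub_smul_id hAY c
  have hC := rayleighRitz_isSymmetric (A := Y.starProjection.toLinearMap)
    Y.starProjection_isSymmetric X
  have hBe : ∀ i, hB.eigenvalues hXp i = ritzValues hA X hXp i - c :=
    eigenvalues_sub_smul_id hAX hXp c
  have hNe : ∀ i, hN.eigenvalues hYp i = ritzValues hA Y hYp i - c :=
    eigenvalues_sub_smul_id hAY hYp c
  have hBpos : ∀ i, 0 < hB.eigenvalues hXp i := fun i => by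
    rw [hBe]
    exact sub_pos.2 (hmin i)
  have hCpos : ∀ i, 0 < hC.eigenvalues hXp i := ritzValues_starProjection_pos hangle
  have hBN : ∀ y : Y, RCLike.re (inner 𝕜
      ((rayleighRitz A X - (c : 𝕜) • (LinearMap.id : X →ₗ[𝕜] X))
        ((X.orthogonalProjectionOnto.toLinearMap ∘ₗ Y.subtype) y))
      ((X.orthogonalProjectionOnto.toLinearMap ∘ₗ Y.subtype) y)) ≤
      RCLike.re (inner 𝕜 ((rayleighRitz A Y - (c : 𝕜) • (LinearMap.id : Y →ₗ[𝕜] Y)) y) y) :=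
    fun y => by
      rw [re_inner_sub_smul_id, re_inner_sub_smul_id, inner_rayleighRitz_apply,
        inner_rayleighRitz_apply]
      exact re_inner_orthogonalProjection_le hA hX.1 y.2
  have hYpos : ∀ i, c < ritzValues hA Y hYp i := fun i => by
    obtain ⟨μ, hμ0, hμN, -, -⟩ := exists_truncation hB hC hN hXp hYp _
      (rayleighRitz_starProjection_eq X Y) hBpos hCpos hBN one_pos
    have := (hμ0 i).trans_le (hμN i)
    rw [hNe] at this
    exact sub_pos.1 this
  have hle : ∀ i, ritzValues hA Y hYp i ≤ ritzValues hA X hXp i :=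
    ritzValues_le_of_isTopInvariant hA hXp hYp hX
  have hlog : WeaklyMajorizedBy
      (fun i => Real.log ((ritzValues hA X hXp i - c) / (ritzValues hA Y hYp i - c)))
      (fun i => Real.log (1 + Real.tan (principalAngles X Y hXp i) ^ 2)) := by
    simp only [one_add_tan_sq_principalAngles hangle, Real.log_inv]
    refine weaklyMajorizedBy_of_forall_finset (fun i j hij => ?_) fun I hI => ?_
    · exact neg_le_neg (Real.log_le_log (hCpos _)
        (hC.eigenvalues_antitone hXp (Fin.rev_le_rev.2 hij)))
    · have h := sum_log_div_le hB hC hN hXp hYp _ (rayleighRitz_starProjection_eq X Y)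
        hBpos hCpos hBN I hI
      simp only [hBe, hNe] at h
      exact h
  refine ⟨hYpos, fun i => ?_, hlog, fun i => ?_, ?_⟩
  · exact Real.log_nonneg
      ((one_le_div (sub_pos.2 (hYpos i))).2 (sub_le_sub_right (hle i) c))
  · exact div_nonneg (sub_nonneg.2 (hle i)) (sub_pos.2 (hYpos i)).le
  · have h := hlog.exp_sub_one
    have h1 : ∀ i, Real.exp (Real.log ((ritzValues hA X hXp i - c) /
        (ritzValues hA Y hYp i - c))) - 1 =
        (ritzValues hA X hXp i - ritzValues hA Y hYp i) / (ritzValues hA Y hYp i - c) :=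
      fun i => by
        have h0 := sub_pos.2 (hYpos i)
        rw [Real.exp_log (div_pos (sub_pos.2 (hmin i)) h0), div_sub_one h0.ne']
        congr 1
        ring
    have h2 : ∀ i, Real.exp (Real.log (1 + Real.tan (principalAngles X Y hXp i) ^ 2)) - 1 =
        Real.tan (principalAngles X Y hXp i) ^ 2 := fun i => by
      rw [Real.exp_log (by positivity)]
      ring
    simpa only [h1, h2] using h
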